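/- **Definitions.** Let $X$ be a compact metric space and $f:X\to X$ continuous. For $x\in X$ let $\omega(x)$ be the set of accumulation points of the orbit $(f^n(x))_{n\ge 0}$, that is, $\omega(x)=\bigcap_{N}\overline{\{f^n(x):n\ge N\}}$, and for $A\subset X$ let $\beta_f(A)=\{x:\omega(x)\subset A\}$. A set $A$ is forward invariant if $f(A)\subset A$. A compact forward invariant set $A$ is a *(Milnor) topological attractor* of $f$ if $\beta_f(A)$ is not meager and $\beta_f(A)\setminus\beta_f(A')$ is not meager for every compact forward invariant $A'\subsetneq A$. The *generic limit set* of $f$ is the smallest closed set that contains $\omega(x)$ for all $x$ in some residual subset of $X$. Let $M=\{(x,y)\in\mathbb R^2: x^2+y^2\le 9\}$, $D=\{(x,y)\in M: x<0\}$, $Z=\{(x,y)\in M:x<1\}$, $q=(2,0)$, and let $S^1=\mathbb R/2\pi\mathbb Z$ with the arcs $I_j=[\,j\pi/4,(j+1)\pi/4\,]$, $j=0,\dots,7$. A map of $M$, or of the solid torus $S^1\times M$, to itself is called smooth if it is the restriction of a $C^\infty$ map defined on a neighborhood of $M$ in $\mathbb R^2$, respectively of $S^1\times M$ in $S^1\times\mathbb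 R^2$ (with values in $\mathbb R^2$, respectively $S^1\times\mathbb R^2$). **Theorem.** There exists a smooth map $F:S^1\times M\to S^1\times M$ that is a skew product over the octupling map, $$F(\varphi,p)=(8\varphi,f_\varphi(p)),$$ with the following properties. 1. There are maps $f_2,f_4,f_6:M\to M$ such that each $f_i$ ($i=2,4,6$) is smooth on $M$, is contracting on $Z$ (there is $\lambda<1$ with $\operatorname{dist}(f_i(a),f_i(b))\le\lambda\operatorname{dist}(a,b)$ for all $a,b\in Z$), and satisfies $f_i(M\setminus Z)\subset D$ and $f_i(Z)\subset Z$; moreover $$D\subset f_2(D)\cup f_4(D)\cup f_6(D)\subset Z.$$ 2. For $\varphi\in I_0$ the fiber map $f_\varphi$ is the constant map $f_\varphi\equiv q$, and $f_\varphi=f_j$ for $\varphi\in I_j$, $j=2,4,6$. For $\varphi\in I_1\cup I_3\cup I_5\cup I_7$ the map $f_\varphi$ either is constant with value on the axis $\{y=0\}$, or is smooth with $f_\varphi(M)\subset Z$. 3. There is a set $A\subset S^1\times M$ that is a Milnor topological attractor of $F$, satisfies $F(A)=A$, and is the generic limit set of $F$, whose interior (in $S^1\times M$) is not forward invariant: $F(\operatorname{int}A)\not\subset\operatorname{int}A$.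 -/

import Mathlib

open Set Filter Topology
open scoped NNReal Manifold ContDiff

/-! Attractors of a self-map of a topological space. -/

section Attractors

variable {X : Type*} [TopologicalSpace X]

/-- The `ω`-limit set of the point `x` under the iterates of `f`. -/
def omegaLimitPt (f : X → X) (x : X) : Set X :=
  omegaLimit atTop (fun (n : ℕ) (y : X) => f^[n] y) {x}

/-- The basin of attraction of `A`: the points whose `ω`-limit set lies in `A`. -/
def attractionBasin (f : X → X) (A : Set X) : Set X :=
  {x | omegaLimitPt f x ⊆ A}

/-- A (minimal) topological attractor in the sense of Milnor: a compact forward invariant set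
whose basin is not meager, and such that the part of the basin that is lost by passing to a
compact forward invariant proper subset is never meager. -/
structure IsTopologicalAttractor (f : X → X) (A : Set X) : Prop where
  isCompact : IsCompact A
  mapsTo : MapsTo f A A
  basin_not_meagre : ¬ IsMeagre (attractionBasin f A)
  minimal : ∀ A' : Set X, A' ⊂ A → IsCompact A' → MapsTo f A' A' →
    ¬ IsMeagre (attractionBasin f A \ attractionBasin f A')

/-- `A` is the smallest closed set that contains the `ω`-limit sets of all points of some residual
set (the topological version of the likely limit set). -/
structure IsGenericLimitSet (f : X → X) (A : Set X) : Prop where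
  isClosed : IsClosed A
  attracts : ∀ᶠ x in residual X, omegaLimitPt f x ⊆ A
  least : ∀ B : Set X, IsClosed B → (∀ᶠ x in residual X, omegaLimitPt f x ⊆ B) → A ⊆ B

end Attractors

/-! The solid torus and its smooth self-maps. -/

/-- The Euclidean plane. -/
abbrev Plane : Type := EuclideanSpace ℝ (Fin 2)

/-- The closed disk of radius `3` centered at the origin. -/
abbrev FiberDisk : Type := Metric.closedBall (0 : Plane) 3

/-- The solid torus: the product of the unit circle and the closed disk. -/
abbrev SolidTorus : Type := Circle × FiberDisk

/-- Inclusion of the solid torus in the open manifold `S¹ × ℝ²`. -/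
def SolidTorus.incl (p : SolidTorus) : Circle × Plane := (p.1, (p.2 : Plane))

/-- A self-map of the disk is smooth if it is the restriction of a `C^∞` map
defined on a neighborhood of the disk in the plane. -/
def IsSmoothDiskMap (g : FiberDisk → FiberDisk) : Prop :=
  ∃ (U : Set Plane) (G : Plane → Plane), IsOpen U ∧ Metric.closedBall (0 : Plane) 3 ⊆ U ∧
    ContDiffOn ℝ ∞ G U ∧ ∀ p : FiberDisk, (g p : Plane) = G p

/-- A self-map of the solid torus is smooth if it is the restriction of a `C^∞` map
defined on a neighborhood of the solid torus in `S¹ × ℝ²`. -/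
def IsSmoothSolidTorusMap (F : SolidTorus → SolidTorus) : Prop :=
  ∃ (U : Set (Circle × Plane)) (G : Circle × Plane → Circle × Plane),
    IsOpen U ∧ range SolidTorus.incl ⊆ U ∧
    ContMDiffOn ((𝓡 1).prod 𝓘(ℝ, Plane)) ((𝓡 1).prod 𝓘(ℝ, Plane)) ∞ G U ∧
    ∀ p : SolidTorus, (F p).incl = G p.incl

/-! The fiber maps. -/

/-- The part `x < 0` of the disk. -/
def regionD : Set FiberDisk := {p | (p : Plane) 0 < 0}

/-- The part `x < 1` of the disk. -/
def regionZ : Set FiberDisk := {p | (p : Plane) 0 < 1}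

/-- The arc of the points `e^{iφ}` with `jπ/4 ≤ φ ≤ (j+1)π/4`. -/
def octant (j : ℕ) : Set Circle :=
  (fun φ : ℝ => Circle.exp φ) '' Icc (j * (Real.pi / 4)) ((j + 1) * (Real.pi / 4))

/-- Requirements on a single one of the three contracting fiber maps. -/
structure IsContractingFiberMap (g : FiberDisk → FiberDisk) : Prop where
  smooth : IsSmoothDiskMap g
  contracting : ∃ K : ℝ≥0, K < 1 ∧ LipschitzOnWith K g regionZ
  mapsTo_compl : MapsTo g regionZᶜ regionD
  mapsTo : MapsTo g regionZ regionZ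

/-- The conditions on the triple of contracting fiber maps, including the covering condition. -/
structure IsHutchinsonTriple (f₂ f₄ f₆ : FiberDisk → FiberDisk) : Prop where
  fst : IsContractingFiberMap f₂
  snd : IsContractingFiberMap f₄
  trd : IsContractingFiberMap f₆
  covers : regionD ⊆ f₂ '' regionD ∪ f₄ '' regionD ∪ f₆ '' regionD
  image_subset : f₂ '' regionD ∪ f₄ '' regionD ∪ f₆ '' regionD ⊆ regionZ

/-- The family of fiber maps `f` is the constant map to `q = (2, 0)` on octant `0`, is equal to the
maps `f₂`, `f₄`, `f₆` on octants `2`, `4`, `6`, and on the odd octants each fiber map is either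
constant with its value on the axis `y = 0`, or smooth with its image in the region `x < 1`. -/
structure IsFiberFamily (f : Circle → FiberDisk → FiberDisk)
    (f₂ f₄ f₆ : FiberDisk → FiberDisk) : Prop where
  octant_zero : ∀ z ∈ octant 0, ∀ p, (f z p : Plane) = !₂[(2 : ℝ), 0]
  octant_two : ∀ z ∈ octant 2, f z = f₂
  octant_four : ∀ z ∈ octant 4, f z = f₄
  octant_six : ∀ z ∈ octant 6, f z = f₆
  octant_odd : ∀ j ∈ ({1, 3, 5, 7} : Set ℕ), ∀ z ∈ octant j,
    (∃ c : FiberDisk, (c : Plane) 1 = 0 ∧ ∀ p, f z p = c) ∨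
      (IsSmoothDiskMap (f z) ∧ range (f z) ⊆ regionZ)

/-! The attractor is the closure of `circleOrbit F`, the forward orbit of the circle over q = (2,0).
Over octant 0 the whole fiber collapses to q, so an open set of points falls into this orbit.
Octupling makes preimages of any angle dense, so from any open set some point, at an arbitrarily
late time, reaches the angle needed to drop onto a prescribed point of the circle and then follow
its orbit. By Baire, the generic point enters the orbit and visits every open set meeting it, so its
ω-limit set is exactly the closure (`IsFiberFamily.dense_visits`,
`eventually_residual_omegaLimitPt_eq_closure`). Being attractor and generic limit set follows at
once.

The interior contains S¹ × D. Since D is covered by the contracted images of D, a point of D can be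
pulled back n times inside D; running an orbit point forward through the same maps approximates it
with error at most 6Kⁿ. The base angle is unrestricted because each octant covers the circle under
octupling (`IsFiberFamily.exists_mem_circleOrbit_dist_le`). On the other hand every image of F lies
in {x ≤ 1} ∪ {y = 0}, so near q the attractor is thin and (z, q) is never interior. A point of S¹ ×
D over octant 0 is mapped to such a point.

The contracting maps are a smooth folding of the plane into {x ≤ 0}, scaled by 49/50, followed by a
smooth weak contraction of the plane onto M. The folding handles M \ Z and the covering near x = 0;
the radial map brings back what the translations push out of M. Bump functions with disjoint
supports glue the four maps over the circle. -/

/-! ### Generic limit sets as closures of recurrent sets -/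

section GenericOmega

variable {X : Type*} [TopologicalSpace X] {F : X → X}

/-- If a forward invariant set `O` absorbs some open set that meets it, and every open set that
meets `O` is visited infinitely often by a dense set of orbits, then `closure O` is the
`ω`-limit set of the generic point. -/
theorem eventually_residual_omegaLimitPt_eq_closure [SecondCountableTopology X]
    (hF : Continuous F) {O U : Set X} (hO : MapsTo F O O) (hU : IsOpen U)
    (hUO : (U ∩ O).Nonempty) (hFU : MapsTo F U O)
    (hdense : ∀ W : Set X, IsOpen W → (W ∩ O).Nonempty →
      ∀ N : ℕ, Dense {x | ∃ n ≥ N, F^[n] x ∈ W}) :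
    ∀ᶠ x in residual X, omegaLimitPt F x = closure O := by
  have hvisit : ∀ W : Set X, IsOpen W → (W ∩ O).Nonempty →
      ∀ᶠ x in residual X, ∀ N : ℕ, ∃ n ≥ N, F^[n] x ∈ W := by
    intro W hW hWO
    refine eventually_countable_forall.2 fun N => ?_
    refine residual_of_dense_open ?_ (hdense W hW hWO N)
    have : {x | ∃ n ≥ N, F^[n] x ∈ W} = ⋃ n ≥ N, F^[n] ⁻¹' W := by ext; simp
    rw [this]
    exact isOpen_biUnion fun n _ => hW.preimage (hF.iterate n)
  obtain ⟨b, hbc, -, hb⟩ := TopologicalSpace.exists_countable_basis X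
  have hbasis : ∀ᶠ x in residual X, ∀ W ∈ b, (W ∩ O).Nonempty →
      ∀ N : ℕ, ∃ n ≥ N, F^[n] x ∈ W := by
    refine (eventually_countable_ball hbc).2 fun W hW => ?_
    by_cases h : (W ∩ O).Nonempty
    · filter_upwards [hvisit W (hb.isOpen hW) h] with x hx _ using hx
    · exact Eventually.of_forall fun x hx => absurd hx h
  filter_upwards [hbasis, hvisit U hU hUO] with x hx hxU
  refine Subset.antisymm ?_ ?_
  -- A single visit to `U` suffices: from the next iterate on, the orbit stays in `O`.
  · obtain ⟨n, -, hn⟩ := hxU 0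
    have hev : ∀ k, F^[k + (n + 1)] x ∈ O := by
      intro k
      rw [Function.iterate_add_apply, Function.iterate_succ_apply']
      exact hO.iterate k (hFU hn)
    refine (omegaLimit_subset_closure_image2 _ _ _ (mem_atTop (n + 1))).trans
      (closure_mono ?_)
    rintro _ ⟨m, hm, y, rfl, rfl⟩
    obtain ⟨k, rfl⟩ := Nat.exists_eq_add_of_le' hm
    exact hev k
  · intro a ha
    refine (mem_omegaLimit_singleton_iff_mapClusterPt _ _ _ _).2
      (mapClusterPt_iff_frequently.2 fun V hV => ?_)
    obtain ⟨W, hW, haW, hWV⟩ := hb.mem_nhds_iff.1 hV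
    have := hx W hW (mem_closure_iff.1 ha W (hb.isOpen hW) haW)
    exact frequently_atTop.2 fun N => (this N).imp fun n hn => ⟨hn.1, hWV hn.2⟩

variable {A : Set X}

theorem isGenericLimitSet_of_eventually_eq [BaireSpace X] [Nonempty X] (hA : IsClosed A)
    (h : ∀ᶠ x in residual X, omegaLimitPt F x = A) : IsGenericLimitSet F A where
  isClosed := hA
  attracts := h.mono fun _ hx => hx.subset
  least B _ hB := by
    obtain ⟨x, hx, hxB⟩ := (dense_of_mem_residual (h.and hB)).nonempty
    exact hx ▸ hxB

theorem isTopologicalAttractor_of_eventually_eq [BaireSpace X] [Nonempty X] (hA : IsCompact A)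
    (hFA : MapsTo F A A) (h : ∀ᶠ x in residual X, omegaLimitPt F x = A) :
    IsTopologicalAttractor F A where
  isCompact := hA
  mapsTo := hFA
  basin_not_meagre := not_isMeagre_of_mem_residual (h.mono fun _ hx => hx.subset)
  minimal _ hA' _ _ := not_isMeagre_of_mem_residual <| h.mono fun _ hx =>
    ⟨hx.subset, fun hx' => hA'.2 (hx.symm.subset.trans hx')⟩

end GenericOmega

/-! ### The octupling map of the circle -/

theorem Circle.exp_natCast_mul_eq_pow (n : ℕ) (x : ℝ) : Circle.exp (n * x) = Circle.exp x ^ n := by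
  induction n with
  | zero => simp
  | succ n ih => rw [pow_succ, ← ih, ← Circle.exp_add]; congr 1; push_cast; ring

theorem Circle.exists_exp_eq (z : Circle) : ∃ a ∈ Ico 0 (2 * Real.pi), Circle.exp a = z := by
  obtain ⟨x, rfl⟩ := Circle.exp_surjective z
  obtain ⟨y, hy, hxy⟩ := Circle.periodic_exp.exists_mem_Ico₀ Real.two_pi_pos x
  exact ⟨y, hy, hxy.symm⟩

/-- An octant has length π/4, so octupling wraps it once around the circle. This lets the fiber map
be chosen freely when a point is pulled back. -/
theorem exists_mem_octant_pow_eq (j : ℕ) (z : Circle) : ∃ w ∈ octant j, w ^ 8 = z := by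
  obtain ⟨a, ha, rfl⟩ := z.exists_exp_eq
  refine ⟨_, ⟨a / 8 + j * (Real.pi / 4), ⟨by linarith [ha.1], by linarith [ha.2]⟩, rfl⟩, ?_⟩
  change Circle.exp _ ^ 8 = _
  rw [← Circle.exp_natCast_mul_eq_pow, Circle.exp_eq_exp]
  exact ⟨j, by push_cast; ring⟩

theorem exists_mem_octant (z : Circle) : ∃ j < 8, z ∈ octant j := by
  obtain ⟨a, ha, rfl⟩ := z.exists_exp_eq
  have hpi : 0 < Real.pi / 4 := by positivity
  have h0 : 0 ≤ a / (Real.pi / 4) := div_nonneg ha.1 hpi.le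
  refine ⟨⌊a / (Real.pi / 4)⌋₊, ?_, a, ⟨?_, ?_⟩, rfl⟩
  · rw [Nat.floor_lt h0, div_lt_iff₀ hpi]
    push_cast; linarith [ha.2]
  · exact (le_div_iff₀ hpi).1 (Nat.floor_le h0)
  · exact ((div_lt_iff₀ hpi).1 (Nat.lt_floor_add_one _)).le

/-- Backward orbits of the octupling map accumulate everywhere. -/
theorem exists_pow_eight_pow_eq_mem (w : Circle) {V : Set Circle} (hV : IsOpen V)
    (hne : V.Nonempty) (N : ℕ) : ∃ n ≥ N, ∃ z ∈ V, z ^ 8 ^ n = w := by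
  obtain ⟨z, hz⟩ := hne
  obtain ⟨a, rfl⟩ := Circle.exp_surjective z
  obtain ⟨b, rfl⟩ := Circle.exp_surjective w
  -- The `8 ^ n`-th roots of `w` have arguments spaced by 2π/8ⁿ; `t n` is the last one not exceeding
  -- `a`.
  let k : ℕ → ℤ := fun n => ⌊(8 ^ n * a - b) / (2 * Real.pi)⌋
  let t : ℕ → ℝ := fun n => (b + k n * (2 * Real.pi)) / 8 ^ n
  have hpi := Real.two_pi_pos
  have hbound : ∀ n, dist (t n) a ≤ 2 * Real.pi * (1 / 8) ^ n := by
    intro n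
    have h8 : (0 : ℝ) < 8 ^ n := by positivity
    have h1 : k n * (2 * Real.pi) ≤ 8 ^ n * a - b := (le_div_iff₀ hpi).1 (Int.floor_le _)
    have h2 : 8 ^ n * a - b < (k n + 1) * (2 * Real.pi) :=
      (div_lt_iff₀ hpi).1 (Int.lt_floor_add_one _)
    rw [one_div, inv_pow, ← div_eq_mul_inv, le_div_iff₀ h8, Real.dist_eq,
      ← abs_of_pos h8, ← abs_mul, sub_mul, div_mul_cancel₀ _ h8.ne', abs_le]
    constructor <;> linarith
  have ht : Tendsto t atTop (𝓝 a) := by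
    refine tendsto_iff_dist_tendsto_zero.2
      (squeeze_zero (fun _ => dist_nonneg) hbound ?_)
    simpa using (tendsto_pow_atTop_nhds_zero_of_lt_one (r := (1 / 8 : ℝ)) (by norm_num)
      (by norm_num)).const_mul (2 * Real.pi)
  have hev : ∀ᶠ n in atTop, Circle.exp (t n) ∈ V :=
    (Circle.exp.continuous.tendsto a).comp ht (hV.mem_nhds hz)
  obtain ⟨n, hnV, hnN⟩ := (hev.and (eventually_ge_atTop N)).exists
  refine ⟨n, hnN, _, hnV, ?_⟩
  rw [← Circle.exp_natCast_mul_eq_pow, Circle.exp_eq_exp]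
  refine ⟨k n, ?_⟩
  simp only [t]; push_cast; field_simp

theorem nonempty_interior_octant (j : ℕ) : (interior (octant j)).Nonempty := by
  have hpi := Real.pi_pos
  have : (fun φ : ℝ => Circle.exp φ) '' Ioo (j * (Real.pi / 4)) ((j + 1) * (Real.pi / 4)) ⊆
      interior (octant j) :=
    interior_maximal (image_mono Ioo_subset_Icc_self)
      (isLocalHomeomorph_circleExp.isOpenMap _ isOpen_Ioo)
  exact ((nonempty_Ioo.2 (by linarith)).image _).mono this

/-! ### The attractor of a skew product over the octupling map -/

section SkewProduct

variable {F : SolidTorus → SolidTorus} {f : Circle → FiberDisk → FiberDisk}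
  {f₂ f₄ f₆ : FiberDisk → FiberDisk}

/-- The point `(2, 0)` of the disk. -/
noncomputable def diskPoint : FiberDisk :=
  ⟨!₂[(2 : ℝ), 0], by simp [EuclideanSpace.norm_eq]; norm_num⟩

/-- The forward orbit of the circle `S¹ × {(2, 0)}`. -/
def circleOrbit (F : SolidTorus → SolidTorus) : Set SolidTorus :=
  ⋃ n : ℕ, F^[n] '' (univ ×ˢ {diskPoint})

theorem mem_circleOrbit (z : Circle) : (z, diskPoint) ∈ circleOrbit F :=
  mem_iUnion.2 ⟨0, (z, diskPoint), by simp⟩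

theorem mapsTo_circleOrbit : MapsTo F (circleOrbit F) (circleOrbit F) := by
  rintro x hx
  obtain ⟨n, y, hy, rfl⟩ := mem_iUnion.1 hx
  exact mem_iUnion.2 ⟨n + 1, y, hy, Function.iterate_succ_apply' F n y⟩

theorem image_circleOrbit (hq : ∀ z, (z, diskPoint) ∈ F '' circleOrbit F) :
    F '' circleOrbit F = circleOrbit F := by
  refine Subset.antisymm mapsTo_circleOrbit.image_subset fun x hx => ?_
  obtain ⟨n, ⟨z, p⟩, hy, rfl⟩ := mem_iUnion.1 hx
  obtain rfl : p = diskPoint := by simpa using hy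
  cases n with
  | zero => exact hq z
  | succ n =>
    exact ⟨F^[n] (z, diskPoint), mem_iUnion.2 ⟨n, _, hy, rfl⟩,
      (Function.iterate_succ_apply' F n _).symm⟩

theorem iterate_fst (hF : ∀ z p, F (z, p) = (z ^ 8, f z p)) (n : ℕ) (x : SolidTorus) :
    (F^[n] x).1 = x.1 ^ 8 ^ n := by
  induction n with
  | zero => simp
  | succ n ih => rw [Function.iterate_succ_apply', hF, ih, pow_succ 8 n, pow_mul]

theorem IsFiberFamily.apply_octant_zero (hf : IsFiberFamily f f₂ f₄ f₆) {z : Circle}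
    (hz : z ∈ octant 0) (p : FiberDisk) : f z p = diskPoint :=
  Subtype.ext (hf.octant_zero z hz p)

/-- The target point is hit exactly, not only approached: once the angle is the root ψ in octant 0,
the fiber coordinate is forgotten, and the next iterate is the starting point on the circle over q.
-/
theorem IsFiberFamily.dense_visits (hf : IsFiberFamily f f₂ f₄ f₆)
    (hF : ∀ z p, F (z, p) = (z ^ 8, f z p)) {W : Set SolidTorus}
    (hWO : (W ∩ circleOrbit F).Nonempty) (N : ℕ) : Dense {x | ∃ n ≥ N, F^[n] x ∈ W} := by
  obtain ⟨w, hwW, hwO⟩ := hWO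
  obtain ⟨m, ⟨φ, p⟩, hy, rfl⟩ := mem_iUnion.1 hwO
  obtain rfl : p = diskPoint := by simpa using hy
  obtain ⟨ψ, hψ, rfl⟩ := exists_mem_octant_pow_eq 0 φ
  refine dense_iff_inter_open.2 fun V hV ⟨⟨z, p⟩, hzV⟩ => ?_
  obtain ⟨n, hn, z', hz', hzn⟩ := exists_pow_eight_pow_eq_mem ψ
    (hV.preimage (Continuous.prodMk_left p)) ⟨z, hzV⟩ N
  refine ⟨(z', p), hz', m + (n + 1), by omega, ?_⟩
  have h1 : F^[n] (z', p) = (ψ, (F^[n] (z', p)).2) :=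
    Prod.ext ((iterate_fst hF n _).trans hzn) rfl
  rwa [Function.iterate_add_apply, Function.iterate_succ_apply', h1, hF,
    hf.apply_octant_zero hψ]

theorem IsFiberFamily.eventually_omegaLimitPt_eq (hf : IsFiberFamily f f₂ f₄ f₆)
    (hF : ∀ z p, F (z, p) = (z ^ 8, f z p)) (hFc : Continuous F) :
    ∀ᶠ x in residual SolidTorus, omegaLimitPt F x = closure (circleOrbit F) := by
  obtain ⟨z, hz⟩ := nonempty_interior_octant 0
  refine eventually_residual_omegaLimitPt_eq_closure hFc mapsTo_circleOrbit
    (isOpen_interior.prod isOpen_univ) ⟨(z, diskPoint), ⟨hz, mem_univ _⟩, mem_circleOrbit z⟩ ?_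
    fun W _ hW N => hf.dense_visits hF hW N
  rintro ⟨z, p⟩ hzp
  rw [hF, hf.apply_octant_zero (interior_subset hzp.1)]
  exact mem_circleOrbit _

theorem IsFiberFamily.image_circleOrbit (hf : IsFiberFamily f f₂ f₄ f₆)
    (hF : ∀ z p, F (z, p) = (z ^ 8, f z p)) : F '' circleOrbit F = circleOrbit F := by
  refine _root_.image_circleOrbit fun z => ?_
  obtain ⟨w, hw, rfl⟩ := exists_mem_octant_pow_eq 0 z
  exact ⟨_, mem_circleOrbit w, by rw [hF, hf.apply_octant_zero hw]⟩

theorem IsContractingFiberMap.mem_regionZ {g : FiberDisk → FiberDisk}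
    (hg : IsContractingFiberMap g) (p : FiberDisk) : g p ∈ regionZ := by
  by_cases hp : p ∈ regionZ
  · exact hg.mapsTo hp
  · have : (g p : Plane) 0 < 0 := hg.mapsTo_compl hp
    exact this.trans one_pos

/-- The fibers of the orbit of `S¹ × {(2, 0)}` accumulate at every point of the region covered by
the three contracting maps. -/
theorem IsFiberFamily.exists_mem_circleOrbit_dist_le (hf : IsFiberFamily f f₂ f₄ f₆)
    (hF : ∀ z p, F (z, p) = (z ^ 8, f z p)) (ht : IsHutchinsonTriple f₂ f₄ f₆) :
    ∃ K : ℝ≥0, K < 1 ∧ ∀ n : ℕ, ∀ z : Circle, ∀ d ∈ regionD, ∃ e ∈ regionZ,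
      (z, e) ∈ circleOrbit F ∧ dist d e ≤ K ^ n * 6 := by
  obtain ⟨K₂, hK₂, h₂⟩ := ht.fst.contracting
  obtain ⟨K₄, hK₄, h₄⟩ := ht.snd.contracting
  obtain ⟨K₆, hK₆, h₆⟩ := ht.trd.contracting
  let K := max K₂ (max K₄ K₆)
  refine ⟨K, max_lt hK₂ (max_lt hK₄ hK₆), fun n => ?_⟩
  induction n with
  | zero =>
    intro z d _
    -- Any orbit point over `z` with fiber coordinate in Z will do, as the disk has diameter 6.
    obtain ⟨w, hw, rfl⟩ := exists_mem_octant_pow_eq 2 z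
    refine ⟨f₂ diskPoint, ht.fst.mem_regionZ _, ?_, ?_⟩
    · rw [← hf.octant_two w hw, ← hF]
      exact mapsTo_circleOrbit (mem_circleOrbit w)
    · have h1 := mem_closedBall_zero_iff.1 d.2
      have h2 := mem_closedBall_zero_iff.1 (f₂ diskPoint).2
      have := dist_le_norm_add_norm (d : Plane) (f₂ diskPoint : Plane)
      rw [pow_zero, one_mul, Subtype.dist_eq]
      linarith
  | succ n ih =>
    have key : ∀ (j : ℕ) (g : FiberDisk → FiberDisk), (∀ z ∈ octant j, f z = g) →
        LipschitzOnWith K g regionZ → MapsTo g regionZ regionZ → ∀ z : Circle,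
        ∀ d ∈ g '' regionD, ∃ e ∈ regionZ,
          (z, e) ∈ circleOrbit F ∧ dist d e ≤ K ^ (n + 1) * 6 := by
      rintro j g hj hK hgZ z _ ⟨d, hd, rfl⟩
      obtain ⟨w, hw, rfl⟩ := exists_mem_octant_pow_eq j z
      obtain ⟨e, heZ, heO, hde⟩ := ih w d hd
      refine ⟨g e, hgZ heZ, ?_, ?_⟩
      · rw [← hj w hw, ← hF]
        exact mapsTo_circleOrbit heO
      -- Contraction is only available on Z, which is why `e ∈ regionZ` is carried through the
      -- induction.
      · have hdZ : d ∈ regionZ := lt_trans (show (d : Plane) 0 < 0 from hd) one_pos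
        calc dist (g d) (g e) ≤ K * dist d e := hK.dist_le_mul d hdZ e heZ
          _ ≤ K * (K ^ n * 6) := by gcongr
          _ = K ^ (n + 1) * 6 := by ring
    intro z d hd
    rcases ht.covers hd with (h | h) | h
    · exact key 2 f₂ hf.octant_two (h₂.weaken (le_max_left _ _)) ht.fst.mapsTo z d h
    · exact key 4 f₄ hf.octant_four
        (h₄.weaken ((le_max_left _ _).trans (le_max_right _ _))) ht.snd.mapsTo z d h
    · exact key 6 f₆ hf.octant_six
        (h₆.weaken ((le_max_right _ _).trans (le_max_right _ _))) ht.trd.mapsTo z d h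

theorem IsFiberFamily.prod_regionD_subset (hf : IsFiberFamily f f₂ f₄ f₆)
    (hF : ∀ z p, F (z, p) = (z ^ 8, f z p)) (ht : IsHutchinsonTriple f₂ f₄ f₆) :
    (univ : Set Circle) ×ˢ regionD ⊆ closure (circleOrbit F) := by
  rintro ⟨z, d⟩ ⟨-, hd⟩
  obtain ⟨K, hK, h⟩ := hf.exists_mem_circleOrbit_dist_le hF ht
  refine Metric.mem_closure_iff.2 fun ε hε => ?_
  obtain ⟨n, hn⟩ := exists_pow_lt_of_lt_one (show (0 : ℝ) < ε / 6 by positivity)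
    (show (K : ℝ) < 1 from hK)
  obtain ⟨e, -, heO, hde⟩ := h n z d hd
  refine ⟨_, heO, ?_⟩
  rw [dist_prod_same_left]
  linarith

/-- The bound is non-strict so that the condition is closed and passes to the closure of the orbit.
-/
theorem IsFiberFamily.apply_mem (hf : IsFiberFamily f f₂ f₄ f₆)
    (ht : IsHutchinsonTriple f₂ f₄ f₆) (z : Circle) (p : FiberDisk) :
    (f z p : Plane) 0 ≤ 1 ∨ (f z p : Plane) 1 = 0 := by
  have hZ : ∀ x ∈ regionZ, (x : Plane) 0 ≤ 1 := fun x hx => le_of_lt hx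
  have hodd : ∀ j ∈ ({1, 3, 5, 7} : Set ℕ), z ∈ octant j →
      (f z p : Plane) 0 ≤ 1 ∨ (f z p : Plane) 1 = 0 := by
    intro j hj hz
    rcases hf.octant_odd j hj z hz with ⟨c, hc, h⟩ | ⟨-, h⟩
    · exact .inr (h p ▸ hc)
    · exact .inl (hZ _ (h (mem_range_self p)))
  obtain ⟨j, hj, hz⟩ := exists_mem_octant z
  interval_cases j
  · right; rw [hf.octant_zero z hz]; simp
  · exact hodd 1 (by simp) hz
  · left; rw [hf.octant_two z hz]; exact hZ _ (ht.fst.mem_regionZ p)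
  · exact hodd 3 (by simp) hz
  · left; rw [hf.octant_four z hz]; exact hZ _ (ht.snd.mem_regionZ p)
  · exact hodd 5 (by simp) hz
  · left; rw [hf.octant_six z hz]; exact hZ _ (ht.trd.mem_regionZ p)
  · exact hodd 7 (by simp) hz

theorem continuous_diskCoord (i : Fin 2) :
    Continuous fun x : SolidTorus => (x.2 : Plane) i :=
  (EuclideanSpace.proj (𝕜 := ℝ) i).continuous.comp (continuous_subtype_val.comp continuous_snd)

theorem IsFiberFamily.closure_circleOrbit_subset (hf : IsFiberFamily f f₂ f₄ f₆)
    (hF : ∀ z p, F (z, p) = (z ^ 8, f z p)) (ht : IsHutchinsonTriple f₂ f₄ f₆) :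
    closure (circleOrbit F) ⊆ {x | (x.2 : Plane) 0 ≤ 1 ∨ (x.2 : Plane) 1 = 0} := by
  refine closure_minimal ?_ ?_
  · rw [← hf.image_circleOrbit hF]
    rintro _ ⟨⟨z, p⟩, -, rfl⟩
    rw [hF]
    exact hf.apply_mem ht z p
  · exact (isClosed_le (continuous_diskCoord 0) continuous_const).union
      (isClosed_eq (continuous_diskCoord 1) continuous_const)

theorem IsFiberFamily.notMem_interior (hf : IsFiberFamily f f₂ f₄ f₆)
    (hF : ∀ z p, F (z, p) = (z ^ 8, f z p)) (ht : IsHutchinsonTriple f₂ f₄ f₆) (z : Circle) :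
    (z, diskPoint) ∉ interior (closure (circleOrbit F)) := by
  intro h
  -- The segment x = 2 in the fiber over `z` meets {x ≤ 1} ∪ {y = 0} only at q.
  let γ : Icc (-1 : ℝ) 1 → SolidTorus := fun t =>
    (z, ⟨!₂[(2 : ℝ), t], by
      rw [mem_closedBall_zero_iff, EuclideanSpace.norm_eq]
      refine Real.sqrt_le_iff.2 ⟨by norm_num, ?_⟩
      have := abs_le.2 t.2
      have : (t : ℝ) ^ 2 ≤ 1 := (sq_le_one_iff_abs_le_one _).2 this
      simp only [Real.norm_eq_abs, sq_abs, Fin.sum_univ_two, Matrix.cons_val_zero,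
        Matrix.cons_val_one]
      linarith⟩)
  have hγ : Continuous γ := by
    refine continuous_const.prodMk (Continuous.subtype_mk ?_ _)
    refine (PiLp.continuous_toLp 2 _).comp (continuous_pi fun i => ?_)
    fin_cases i
    · exact continuous_const
    · exact continuous_subtype_val
  have h0 : γ ⟨0, by norm_num⟩ ∈ interior (closure (circleOrbit F)) := h
  obtain ⟨ε, hε, hball⟩ := Metric.isOpen_iff.1 (isOpen_interior.preimage hγ) _ h0
  have hpos : 0 < min (ε / 2) 1 := by positivity
  have hmem : (⟨min (ε / 2) 1, by linarith, min_le_right _ _⟩ : Icc (-1 : ℝ) 1) ∈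
      Metric.ball (⟨0, by norm_num⟩ : Icc (-1 : ℝ) 1) ε := by
    rw [Metric.mem_ball, Subtype.dist_eq, Real.dist_eq, sub_zero, abs_of_pos hpos]
    linarith [min_le_left (ε / 2) 1]
  rcases hf.closure_circleOrbit_subset hF ht (interior_subset (hball hmem)) with h1 | h1
  · have : (2 : ℝ) ≤ 1 := h1
    norm_num at this
  · exact hpos.ne' h1

theorem IsFiberFamily.not_mapsTo_interior (hf : IsFiberFamily f f₂ f₄ f₆)
    (hF : ∀ z p, F (z, p) = (z ^ 8, f z p)) (ht : IsHutchinsonTriple f₂ f₄ f₆) :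
    ¬ MapsTo F (interior (closure (circleOrbit F))) (interior (closure (circleOrbit F))) := by
  intro h
  obtain ⟨z, hz⟩ := nonempty_interior_octant 0
  have hopen : IsOpen ((univ : Set Circle) ×ˢ regionD) := by
    have : (univ : Set Circle) ×ˢ regionD = {x : SolidTorus | (x.2 : Plane) 0 < 0} := by
      ext; simp [regionD]
    rw [this]
    exact isOpen_lt (continuous_diskCoord 0) continuous_const
  obtain ⟨d, hd⟩ : regionD.Nonempty :=
    ⟨⟨!₂[(-1 : ℝ), 0], by simp [EuclideanSpace.norm_eq]⟩, by simp [regionD]⟩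
  have hmem : (z, d) ∈ interior (closure (circleOrbit F)) :=
    interior_maximal (hf.prod_regionD_subset hF ht) hopen ⟨mem_univ _, hd⟩
  have := h hmem
  rw [hF, hf.apply_octant_zero (interior_subset hz)] at this
  exact hf.notMem_interior hF ht _ this

/-- A continuous skew product whose fiber maps form a fiber family has an attractor with an
interior that is not forward invariant. -/
theorem IsFiberFamily.exists_attractor (hf : IsFiberFamily f f₂ f₄ f₆)
    (hF : ∀ z p, F (z, p) = (z ^ 8, f z p)) (ht : IsHutchinsonTriple f₂ f₄ f₆)
    (hFc : Continuous F) :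
    ∃ A : Set SolidTorus, IsTopologicalAttractor F A ∧ F '' A = A ∧ IsGenericLimitSet F A ∧
      ¬ MapsTo F (interior A) (interior A) := by
  have hgen := hf.eventually_omegaLimitPt_eq hF hFc
  have hc : IsCompact (closure (circleOrbit F)) := isClosed_closure.isCompact
  have hne : Nonempty SolidTorus := ⟨(1, diskPoint)⟩
  have himg : F '' closure (circleOrbit F) = closure (circleOrbit F) := by
    rw [image_closure_of_isCompact hc hFc.continuousOn, hf.image_circleOrbit hF]
  exact ⟨_, isTopologicalAttractor_of_eventually_eq hc (mapsTo_iff_image_subset.2 himg.subset) hgen,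
    himg, isGenericLimitSet_of_eventually_eq isClosed_closure hgen, hf.not_mapsTo_interior hF ht⟩

end SkewProduct

/-! ### A smooth weak contraction of the plane onto a disk -/

/-- There is a smooth monotone weak contraction of the line that is the identity up to `3` and
constant from `31/10` on. -/
theorem exists_contDiff_saturating : ∃ k : ℝ → ℝ, ContDiff ℝ ∞ k ∧ Monotone k ∧
    LipschitzWith 1 k ∧ (∀ x ≤ 3, k x = x) ∧ ∀ x ≥ 31 / 10, k x = k (31 / 10) := by
  -- The derivative of `k`: it is 1 up to 3, 0 from 31/10 on, and between 0 and 1 throughout.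
  let ψ : ℝ → ℝ := fun t => 1 - Real.smoothTransition ((t - 3) * 10)
  have hψ : ContDiff ℝ ∞ ψ :=
    contDiff_const.sub (Real.smoothTransition.contDiff.comp
      ((contDiff_id.sub contDiff_const).mul contDiff_const))
  have hint : ∀ a b, IntervalIntegrable ψ MeasureTheory.volume a b := fun a b =>
    hψ.continuous.intervalIntegrable a b
  let k : ℝ → ℝ := fun x => ∫ t in (0 : ℝ)..x, ψ t
  have hk : ∀ x, HasDerivAt k (ψ x) x := fun x => hψ.continuous.integral_hasStrictDerivAt 0 x
    |>.hasDerivAt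
  have hderiv : deriv k = ψ := funext fun x => (hk x).deriv
  have hdiff : Differentiable ℝ k := fun x => (hk x).differentiableAt
  refine ⟨k, contDiff_infty_iff_deriv.2 ⟨hdiff, hderiv ▸ hψ⟩, ?_, ?_, ?_, ?_⟩
  · refine monotone_of_deriv_nonneg hdiff fun x => ?_
    rw [hderiv]
    exact sub_nonneg.2 (Real.smoothTransition.le_one _)
  · refine lipschitzWith_of_nnnorm_deriv_le hdiff fun x => ?_
    rw [hderiv, ← NNReal.coe_le_coe, coe_nnnorm, Real.norm_eq_abs, NNReal.coe_one, abs_le]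
    have h0 := Real.smoothTransition.nonneg ((x - 3) * 10)
    have h1 := Real.smoothTransition.le_one ((x - 3) * 10)
    constructor <;> simp only [ψ] <;> linarith
  · intro x hx
    have : k x = ∫ t in (0 : ℝ)..x, (1 : ℝ) := by
      refine intervalIntegral.integral_congr fun t ht => ?_
      have : t ≤ 3 := ht.2.trans (max_le (by norm_num) hx)
      simp only [ψ]
      rw [Real.smoothTransition.zero_of_nonpos (by linarith), sub_zero]
    rw [this]; simp
  · intro x hx
    have : k x - k (31 / 10) = ∫ t in (31 / 10 : ℝ)..x, (0 : ℝ) := by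
      rw [intervalIntegral.integral_interval_sub_left (hint _ _) (hint _ _)]
      refine intervalIntegral.integral_congr fun t ht => ?_
      rw [uIcc_of_le hx] at ht
      simp only [ψ]
      rw [Real.smoothTransition.one_of_one_le (by linarith [ht.1]), sub_self]
    simpa [sub_eq_zero] using this

/-- A radial profile for a smooth weak contraction of the plane onto the disk of radius `3`. -/
structure IsDiskProfile (h : ℝ → ℝ) : Prop where
  contDiff : ContDiff ℝ ∞ h
  monotone : Monotone h
  lipschitz : LipschitzWith 1 h
  eq_self : ∀ x ≤ 2, h x = x
  le_three : ∀ x, h x ≤ 3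
  eq_three : h (31 / 10) = 3

theorem exists_isDiskProfile : ∃ h, IsDiskProfile h := by
  obtain ⟨k, hk, hmono, hlip, hself, hconst⟩ := exists_contDiff_saturating
  set c := k (31 / 10) with hc
  have h3 : 3 ≤ c := (hself 3 le_rfl).symm.le.trans (hmono (by norm_num))
  have h31 : c ≤ 31 / 10 := by
    have := hlip.dist_le_mul (31 / 10) 0
    rw [hself 0 (by norm_num), ← hc, Real.dist_eq, Real.dist_eq, sub_zero, sub_zero,
      NNReal.coe_one, one_mul, abs_of_pos (by linarith)] at this
    exact this.trans (by norm_num)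
  have hc0 : 0 < c := by linarith
  -- Conjugation by a scaling turns the maximum `c` into exactly 3 without changing slopes. Since 3
  -- ≤ c ≤ 31/10, the value 3 is reached by 31/10, and the identity range still contains everything
  -- up to 2.
  refine ⟨fun x => 3 / c * k (c / 3 * x), ?_, ?_, ?_, ?_, ?_, ?_⟩
  · exact contDiff_const.mul (hk.comp (contDiff_const.mul contDiff_id))
  · intro x y hxy
    have : c / 3 * x ≤ c / 3 * y := by gcongr
    have := hmono this
    dsimp only
    gcongr
  · refine LipschitzWith.of_dist_le_mul fun x y => ?_
    have := hlip.dist_le_mul (c / 3 * x) (c / 3 * y)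
    rw [Real.dist_eq, Real.dist_eq, ← mul_sub, abs_mul, abs_of_pos (by positivity : 0 < c / 3),
      NNReal.coe_one, one_mul] at this
    rw [Real.dist_eq, Real.dist_eq, ← mul_sub, abs_mul, abs_of_pos (by positivity : 0 < 3 / c),
      NNReal.coe_one, one_mul]
    calc 3 / c * |k (c / 3 * x) - k (c / 3 * y)| ≤ 3 / c * (c / 3 * |x - y|) := by gcongr
      _ = |x - y| := by field_simp
  · intro x hx
    rw [hself]
    · field_simp
    · nlinarith
  · intro x
    have : k (c / 3 * x) ≤ c := by
      rcases le_total (c / 3 * x) (31 / 10) with h | h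
      · exact hmono h
      · exact (hconst _ h).le
    calc 3 / c * k (c / 3 * x) ≤ 3 / c * c := by gcongr
      _ = 3 := by field_simp
  · rw [hconst _ (by linarith)]
    field_simp

namespace IsDiskProfile

variable {h : ℝ → ℝ}

theorem nonneg (hh : IsDiskProfile h) {x : ℝ} (hx : 0 ≤ x) : 0 ≤ h x := by
  have := hh.monotone hx
  rwa [hh.eq_self 0 (by norm_num)] at this

theorem pos (hh : IsDiskProfile h) {x : ℝ} (hx : 0 < x) : 0 < h x := by
  rcases le_total x 2 with h2 | h2
  · rwa [hh.eq_self x h2]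
  · have := hh.monotone h2
    rw [hh.eq_self 2 le_rfl] at this
    linarith

theorem le_self (hh : IsDiskProfile h) {x : ℝ} (hx : 0 ≤ x) : h x ≤ x := by
  have := hh.lipschitz.dist_le_mul x 0
  rw [hh.eq_self 0 (by norm_num), Real.dist_eq, Real.dist_eq, sub_zero, sub_zero, NNReal.coe_one,
    one_mul, abs_of_nonneg hx] at this
  exact (le_abs_self _).trans this

end IsDiskProfile

/-- The radial map of the plane with profile `h`. -/
noncomputable def radialMap (h : ℝ → ℝ) (v : Plane) : Plane := (h ‖v‖ / ‖v‖) • v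

section RadialMap

variable {h : ℝ → ℝ}

theorem IsDiskProfile.norm_radialMap (hh : IsDiskProfile h) (v : Plane) :
    ‖radialMap h v‖ = h ‖v‖ := by
  rw [radialMap, norm_smul, norm_div, norm_norm, Real.norm_eq_abs,
    abs_of_nonneg (hh.nonneg (norm_nonneg v))]
  rcases eq_or_ne ‖v‖ 0 with h0 | h0
  · rw [h0, hh.eq_self 0 (by norm_num), mul_zero]
  · exact div_mul_cancel₀ _ h0

theorem IsDiskProfile.lipschitzWith_radialMap (hh : IsDiskProfile h) :
    LipschitzWith 1 (radialMap h) := by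
  refine LipschitzWith.of_dist_le_mul fun v w => ?_
  rw [NNReal.coe_one, one_mul, dist_eq_norm, dist_eq_norm]
  refine abs_le_of_sq_le_sq' ?_ (norm_nonneg _) |>.2
  have ha : ∀ u : Plane, h ‖u‖ / ‖u‖ * ‖u‖ = h ‖u‖ := by
    intro u
    rcases eq_or_ne ‖u‖ 0 with h0 | h0
    · rw [h0, hh.eq_self 0 (by norm_num), mul_zero]
    · exact div_mul_cancel₀ _ h0
  have ha0 : ∀ u : Plane, 0 ≤ h ‖u‖ / ‖u‖ := fun u =>
    div_nonneg (hh.nonneg (norm_nonneg u)) (norm_nonneg u)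
  have ha1 : ∀ u : Plane, h ‖u‖ / ‖u‖ ≤ 1 := fun u =>
    div_le_one_of_le₀ (hh.le_self (norm_nonneg u)) (norm_nonneg u)
  have hd : (h ‖v‖ - h ‖w‖) ^ 2 ≤ (‖v‖ - ‖w‖) ^ 2 := by
    have := hh.lipschitz.dist_le_mul ‖v‖ ‖w‖
    rw [NNReal.coe_one, one_mul, Real.dist_eq, Real.dist_eq] at this
    exact sq_le_sq.2 this
  have hab : h ‖v‖ / ‖v‖ * (h ‖w‖ / ‖w‖) ≤ 1 := mul_le_one₀ (ha1 v) (ha0 w) (ha1 w)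
  have hvw := real_inner_le_norm v w
  -- Radial and angular parts of the distance are separated. With `h` the identity this is the
  -- formula for ‖v - w‖²; both parts only shrink, because `h` is 1-Lipschitz and the factors
  -- h‖u‖/‖u‖ are at most 1.
  have hP : ‖radialMap h v - radialMap h w‖ ^ 2 = (h ‖v‖ - h ‖w‖) ^ 2 +
      2 * (h ‖v‖ / ‖v‖ * (h ‖w‖ / ‖w‖)) * (‖v‖ * ‖w‖ - inner ℝ v w) := by
    rw [norm_sub_sq_real, hh.norm_radialMap, hh.norm_radialMap, radialMap, radialMap,
      real_inner_smul_left, real_inner_smul_right]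
    linear_combination (-2 * h ‖w‖) * ha v - 2 * (h ‖v‖ / ‖v‖ * ‖v‖) * ha w
  rw [hP, norm_sub_sq_real]
  nlinarith

/-- The norm is singular only at the origin, and there the map is locally the identity. -/
theorem IsDiskProfile.contDiff_radialMap (hh : IsDiskProfile h) :
    ContDiff ℝ ∞ (radialMap h) := by
  refine contDiff_iff_contDiffAt.2 fun v => ?_
  rcases eq_or_ne v 0 with rfl | hv
  · refine contDiffAt_id.congr_of_eventuallyEq ?_
    filter_upwards [Metric.ball_mem_nhds (0 : Plane) two_pos] with v hv
    rw [radialMap, hh.eq_self _ (mem_ball_zero_iff.1 hv).le, id]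
    rcases eq_or_ne v 0 with rfl | hv0
    · simp
    · rw [div_self (norm_ne_zero_iff.2 hv0), one_smul]
  · have hn : ContDiffAt ℝ ∞ (fun v : Plane => ‖v‖) v := contDiffAt_norm ℝ hv
    exact ((hh.contDiff.contDiffAt.comp v hn).div hn (norm_ne_zero_iff.2 hv)).smul contDiffAt_id

/-- The preimage is taken on the ray of `d`, by the intermediate value theorem. Positivity of κ
keeps it in the same half plane, so covering the half disk of radius 31/10 by foldings is enough. -/
theorem IsDiskProfile.exists_radialMap_smul_eq (hh : IsDiskProfile h) {d : Plane}
    (hd : ‖d‖ ≤ 3) : ∃ κ : ℝ, 0 < κ ∧ ‖κ • d‖ ≤ 31 / 10 ∧ radialMap h (κ • d) = d := by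
  rcases eq_or_ne d 0 with rfl | hd0
  · exact ⟨1, one_pos, by norm_num, by simp [radialMap]⟩
  have hpos : 0 < ‖d‖ := norm_pos_iff.2 hd0
  have h0 : h 0 = 0 := hh.eq_self 0 (by norm_num)
  obtain ⟨r, hr, hrd⟩ : ‖d‖ ∈ h '' Icc 0 (31 / 10) :=
    intermediate_value_Icc (by norm_num) hh.contDiff.continuous.continuousOn
      ⟨h0.trans_le hpos.le, hd.trans_eq hh.eq_three.symm⟩
  have hr0 : 0 < r := lt_of_le_of_ne hr.1 fun h' => by
    rw [← h', h0] at hrd; exact hpos.ne hrd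
  have hnorm : ‖(r / ‖d‖) • d‖ = r := by
    rw [norm_smul, Real.norm_eq_abs, abs_of_pos (by positivity), div_mul_cancel₀ _ hpos.ne']
  refine ⟨r / ‖d‖, by positivity, hnorm.trans_le hr.2, ?_⟩
  rw [radialMap, hnorm, hrd, smul_smul, div_mul_div_cancel₀ hr0.ne', div_self hpos.ne', one_smul]

end RadialMap

/-! ### The contracting fiber maps -/

/-- The plane is folded along the line `x = 0`, contracted, and translated by `(-m, c)`. -/
noncomputable def foldMap (m c : ℝ) (v : Plane) : Plane :=
  !₂[-(m + 49 / 50 * (√(v 0 ^ 2 + 1) - 1)), c + 49 / 50 * v 1]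

theorem lipschitzWith_foldMap (m c : ℝ) : LipschitzWith (49 / 50) (foldMap m c) := by
  refine LipschitzWith.of_dist_le_mul fun v w => ?_
  have hpos : ∀ x : ℝ, 0 < x ^ 2 + 1 := fun x => by positivity
  have key : ∀ a b : ℝ, (√(a ^ 2 + 1) - √(b ^ 2 + 1)) ^ 2 ≤ (a - b) ^ 2 := by
    intro a b
    have h1 : a * b + 1 ≤ √(a ^ 2 + 1) * √(b ^ 2 + 1) := by
      rw [← Real.sqrt_mul (hpos a).le]
      exact Real.le_sqrt_of_sq_le (by nlinarith [sq_nonneg (a - b)])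
    nlinarith [Real.sq_sqrt (hpos a).le, Real.sq_sqrt (hpos b).le]
  have hK : (((49 / 50 : ℝ≥0) : ℝ≥0) : ℝ) = 49 / 50 := by norm_num
  rw [hK, EuclideanSpace.dist_eq, EuclideanSpace.dist_eq]
  refine Real.sqrt_le_iff.2 ⟨by positivity, ?_⟩
  rw [mul_pow, Real.sq_sqrt (by positivity)]
  simp only [Fin.sum_univ_two, Real.dist_eq, sq_abs, foldMap, Matrix.cons_val_zero,
    Matrix.cons_val_one]
  nlinarith [key (v 0) (w 0)]

theorem contDiff_foldMap (m c : ℝ) : ContDiff ℝ ∞ (foldMap m c) := by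
  have hcoord : ∀ i : Fin 2, ContDiff ℝ ∞ fun v : Plane => v i := fun i =>
    (EuclideanSpace.proj (𝕜 := ℝ) i).contDiff
  refine contDiff_euclidean.2 fun i => ?_
  fin_cases i
  · refine (contDiff_const.add (contDiff_const.mul (ContDiff.sub (ContDiff.sqrt
      (((hcoord 0).pow 2).add contDiff_const) fun v => ?_) contDiff_const))).neg
    positivity
  · exact contDiff_const.add (contDiff_const.mul (hcoord 1))

theorem foldMap_apply_zero_nonpos {m : ℝ} (hm : 0 ≤ m) (c : ℝ) (v : Plane) :
    foldMap m c v 0 ≤ 0 := by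
  have : 1 ≤ √(v 0 ^ 2 + 1) := Real.one_le_sqrt.2 (by nlinarith [sq_nonneg (v 0)])
  simp only [foldMap, Matrix.cons_val_zero]
  linarith

theorem foldMap_apply_zero_neg {m : ℝ} (hm : 0 ≤ m) (c : ℝ) {v : Plane} (hv : v 0 ≠ 0) :
    foldMap m c v 0 < 0 := by
  have : 1 < √(v 0 ^ 2 + 1) := by
    rw [Real.lt_sqrt zero_le_one]
    have := pow_pos (abs_pos.2 hv) 2
    rw [sq_abs] at this
    linarith
  simp only [foldMap, Matrix.cons_val_zero]
  linarith

/-- Solving for the left preimage gives √(v₀² + 1) = s + 1, hence v₀² = s² + 2s. The hypothesis `h`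
is ‖v‖² ≤ 9 multiplied by (49/50)². -/
theorem exists_foldMap_eq {m c : ℝ} {w : Plane} (hw : w 0 < -m)
    (h : (-w 0 - m) ^ 2 + 49 / 25 * (-w 0 - m) + (w 1 - c) ^ 2 ≤ 9 * (49 / 50) ^ 2) :
    ∃ v : Plane, ‖v‖ ≤ 3 ∧ v 0 < 0 ∧ foldMap m c v = w := by
  set s := (-w 0 - m) * (50 / 49) with hs
  have hs0 : 0 < s := by rw [hs]; apply mul_pos <;> [linarith; norm_num]
  have hpos : 0 < s ^ 2 + 2 * s := by positivity
  have hsq := Real.sq_sqrt hpos.le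
  refine ⟨!₂[-√(s ^ 2 + 2 * s), (w 1 - c) * (50 / 49)], ?_, ?_, ?_⟩
  · rw [EuclideanSpace.norm_eq]
    refine Real.sqrt_le_iff.2 ⟨by norm_num, ?_⟩
    simp only [Real.norm_eq_abs, sq_abs, Fin.sum_univ_two, Matrix.cons_val_zero,
      Matrix.cons_val_one, neg_sq, hsq]
    rw [hs]
    nlinarith
  · simpa using hpos
  · ext i
    fin_cases i
    · simp only [foldMap, Fin.zero_eta, Matrix.cons_val_zero, neg_sq, hsq]
      rw [show s ^ 2 + 2 * s + 1 = (s + 1) ^ 2 by ring, Real.sqrt_sq (by linarith), hs]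
      ring
    · simp [foldMap]
      ring

/-- The foldings centered at `(-1, 0)`, `(0, 3/2)` and `(0, -3/2)` cover a half disk. -/
theorem exists_foldMap_cover {w : Plane} (hw : w 0 < 0) (hn : ‖w‖ ≤ 31 / 10) :
    ∃ v : Plane, ‖v‖ ≤ 3 ∧ v 0 < 0 ∧
      (foldMap 1 0 v = w ∨ foldMap 0 (3 / 2) v = w ∨ foldMap 0 (-(3 / 2)) v = w) := by
  have hsq : w 0 ^ 2 + w 1 ^ 2 ≤ (31 / 10) ^ 2 := by
    have := EuclideanSpace.real_norm_sq_eq w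
    rw [Fin.sum_univ_two] at this
    rw [← this]
    exact pow_le_pow_left₀ (norm_nonneg _) hn 2
  -- For w₀ < -1, completing the square bounds the left side by (31/10)² - 1 = 8.61, just under
  -- 9(49/50)² = 8.6436. For -1 ≤ w₀ < 0 it is at most 2.96 + (8/5)², with the sign of w₁ selecting
  -- the shift.
  rcases lt_or_ge (w 0) (-1) with h1 | h1
  · obtain ⟨v, hv, hv0, h⟩ := exists_foldMap_eq (m := 1) (c := 0) h1 (by nlinarith)
    exact ⟨v, hv, hv0, .inl h⟩
  have h3 : |w 1| ≤ 31 / 10 := abs_le_of_sq_le_sq (by nlinarith) (by norm_num)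
  obtain ⟨h3l, h3u⟩ := abs_le.1 h3
  rcases le_total 0 (w 1) with h2 | h2
  · obtain ⟨v, hv, hv0, h⟩ := exists_foldMap_eq (m := 0) (c := 3 / 2) (w := w) (by simpa using hw)
      (by nlinarith)
    exact ⟨v, hv, hv0, .inr (.inl h)⟩
  · obtain ⟨v, hv, hv0, h⟩ := exists_foldMap_eq (m := 0) (c := -(3 / 2)) (w := w)
      (by simpa using hw) (by nlinarith)
    exact ⟨v, hv, hv0, .inr (.inr h)⟩

section FiberMap

variable {h : ℝ → ℝ}

/-- The folding followed by the radial map. -/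
noncomputable def planeFiberMap (h : ℝ → ℝ) (m c : ℝ) (v : Plane) : Plane :=
  radialMap h (foldMap m c v)

theorem IsDiskProfile.norm_planeFiberMap_le (hh : IsDiskProfile h) (m c : ℝ) (v : Plane) :
    ‖planeFiberMap h m c v‖ ≤ 3 :=
  (hh.norm_radialMap _).trans_le (hh.le_three _)

theorem IsDiskProfile.planeFiberMap_apply_zero_nonpos (hh : IsDiskProfile h) {m : ℝ}
    (hm : 0 ≤ m) (c : ℝ) (v : Plane) : planeFiberMap h m c v 0 ≤ 0 :=
  mul_nonpos_of_nonneg_of_nonpos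
    (div_nonneg (hh.nonneg (norm_nonneg _)) (norm_nonneg _)) (foldMap_apply_zero_nonpos hm c v)

theorem IsDiskProfile.planeFiberMap_apply_zero_neg (hh : IsDiskProfile h) {m : ℝ}
    (hm : 0 ≤ m) (c : ℝ) {v : Plane} (hv : v 0 ≠ 0) : planeFiberMap h m c v 0 < 0 := by
  have hneg := foldMap_apply_zero_neg hm c hv
  have hpos : 0 < ‖foldMap m c v‖ := norm_pos_iff.2 fun h0 => by simp [h0] at hneg
  exact mul_neg_of_pos_of_neg (div_pos (hh.pos hpos) hpos) hneg

theorem IsDiskProfile.contDiff_planeFiberMap (hh : IsDiskProfile h) (m c : ℝ) :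
    ContDiff ℝ ∞ (planeFiberMap h m c) :=
  hh.contDiff_radialMap.comp (contDiff_foldMap m c)

theorem IsDiskProfile.lipschitzWith_planeFiberMap (hh : IsDiskProfile h) (m c : ℝ) :
    LipschitzWith (49 / 50) (planeFiberMap h m c) := by
  simpa using! hh.lipschitzWith_radialMap.comp (lipschitzWith_foldMap m c)

theorem isContractingFiberMap_of_coe_eq (hh : IsDiskProfile h) {m : ℝ} (hm : 0 ≤ m) (c : ℝ)
    {g : FiberDisk → FiberDisk} (hg : ∀ p, (g p : Plane) = planeFiberMap h m c p) :
    IsContractingFiberMap g where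
  smooth := ⟨univ, _, isOpen_univ, subset_univ _, (hh.contDiff_planeFiberMap m c).contDiffOn, hg⟩
  contracting := by
    refine ⟨49 / 50, by rw [← NNReal.coe_lt_coe]; norm_num, LipschitzWith.lipschitzOnWith ?_⟩
    refine LipschitzWith.of_dist_le_mul fun p q => ?_
    rw [Subtype.dist_eq, hg, hg]
    exact (hh.lipschitzWith_planeFiberMap m c).dist_le_mul p q
  mapsTo_compl p hp := by
    have hp1 : 1 ≤ (p : Plane) 0 := not_lt.1 hp
    change (g p : Plane) 0 < 0
    rw [hg]
    exact hh.planeFiberMap_apply_zero_neg hm c (by linarith)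
  mapsTo p _ := by
    change (g p : Plane) 0 < 1
    rw [hg]
    exact (hh.planeFiberMap_apply_zero_nonpos hm c p).trans_lt one_pos

theorem isHutchinsonTriple_of_coe_eq (hh : IsDiskProfile h) {f₂ f₄ f₆ : FiberDisk → FiberDisk}
    (h₂ : ∀ p, (f₂ p : Plane) = planeFiberMap h 1 0 p)
    (h₄ : ∀ p, (f₄ p : Plane) = planeFiberMap h 0 (3 / 2) p)
    (h₆ : ∀ p, (f₆ p : Plane) = planeFiberMap h 0 (-(3 / 2)) p) :
    IsHutchinsonTriple f₂ f₄ f₆ := by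
  have c₂ := isContractingFiberMap_of_coe_eq hh zero_le_one _ h₂
  have c₄ := isContractingFiberMap_of_coe_eq hh le_rfl _ h₄
  have c₆ := isContractingFiberMap_of_coe_eq hh le_rfl _ h₆
  refine ⟨c₂, c₄, c₆, fun d hd => ?_, ?_⟩
  · have hd0 : (d : Plane) 0 < 0 := hd
    obtain ⟨κ, hκ, hn, hP⟩ := hh.exists_radialMap_smul_eq (mem_closedBall_zero_iff.1 d.2)
    obtain ⟨v, hv, hv0, hfold⟩ := exists_foldMap_cover
      (w := κ • (d : Plane)) (mul_neg_of_pos_of_neg hκ hd0) hn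
    let p : FiberDisk := ⟨v, mem_closedBall_zero_iff.2 hv⟩
    rcases hfold with h' | h' | h'
    · exact .inl (.inl ⟨p, hv0, Subtype.ext ((h₂ p).trans ((congrArg _ h').trans hP))⟩)
    · exact .inl (.inr ⟨p, hv0, Subtype.ext ((h₄ p).trans ((congrArg _ h').trans hP))⟩)
    · exact .inr ⟨p, hv0, Subtype.ext ((h₆ p).trans ((congrArg _ h').trans hP))⟩
  · rintro _ ((⟨p, -, rfl⟩ | ⟨p, -, rfl⟩) | ⟨p, -, rfl⟩)
    exacts [c₂.mem_regionZ p, c₄.mem_regionZ p, c₆.mem_regionZ p]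

end FiberMap

/-! ### The cut-off functions on the circle -/

/-- The midpoint of the octant `2 * k`. -/
noncomputable def octantCenter (k : Fin 4) : ℂ :=
  Circle.exp ((2 * (k : ℕ) + 1 / 2) * (Real.pi / 4))

/-- A smooth function that is equal to `1` on the octant `2 * k` and vanishes far from it. -/
noncomputable def octantBump (k : Fin 4) : ContDiffBump (octantCenter k) where
  -- A chord from the center to a point of the octant is at most π/8 < 2/5. Twice the outer radius
  -- is 6/5, less than the distance √2 between neighboring centers, so the supports are disjoint.
  rIn := 2 / 5
  rOut := 3 / 5
  rIn_pos := by norm_num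
  rIn_lt_rOut := by norm_num

theorem octantCenter_eq (k : Fin 4) : octantCenter k = octantCenter 0 * Complex.I ^ (k : ℕ) := by
  rw [octantCenter, octantCenter, Circle.coe_exp, Circle.coe_exp, ← Complex.exp_pi_div_two_mul_I,
    ← Complex.exp_nat_mul, ← Complex.exp_add]
  congr 1
  push_cast
  simp
  ring

theorem one_lt_dist_octantCenter {k l : Fin 4} (hkl : k ≠ l) :
    6 / 5 < dist (octantCenter k) (octantCenter l) := by
  have h0 : ‖octantCenter 0‖ = 1 := Circle.norm_coe _
  rw [octantCenter_eq k, octantCenter_eq l, dist_eq_norm, ← mul_sub, norm_mul, h0, one_mul]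
  refine lt_of_pow_lt_pow_left₀ 2 (norm_nonneg _) ?_
  rw [← Complex.normSq_eq_norm_sq]
  fin_cases k <;> fin_cases l <;>
    first
    | exact absurd rfl hkl
    | (simp [pow_succ, Complex.normSq_apply]; try norm_num)

theorem octantBump_eq_one {k : Fin 4} {z : Circle} (hz : z ∈ octant (2 * (k : ℕ))) :
    octantBump k (z : ℂ) = 1 := by
  obtain ⟨a, ⟨ha, ha'⟩, rfl⟩ := hz
  refine (octantBump k).one_of_mem_closedBall (Metric.mem_closedBall.2 ?_)
  set b : ℝ := (2 * (k : ℕ) + 1 / 2) * (Real.pi / 4) with hb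
  have hsub : (Circle.exp a : ℂ) - octantCenter k =
      Circle.exp b * (Complex.exp (Complex.I * ((a - b : ℝ) : ℂ)) - 1) := by
    rw [octantCenter, ← hb, Circle.coe_exp, Circle.coe_exp, mul_sub, ← Complex.exp_add, mul_one]
    congr 2
    push_cast
    ring
  change dist (Circle.exp a : ℂ) _ ≤ _
  rw [dist_eq_norm, hsub, norm_mul, Circle.norm_coe, one_mul]
  refine Real.norm_exp_I_mul_ofReal_sub_one_le.trans ?_
  change |a - b| ≤ 2 / 5
  have := Real.pi_lt_d2
  push_cast at ha ha'
  rw [abs_le]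
  constructor <;> linarith

theorem octantBump_eq_zero_of_ne {k l : Fin 4} (hkl : l ≠ k) {z : ℂ} (hk : octantBump k z ≠ 0) :
    octantBump l z = 0 := by
  refine (octantBump l).zero_of_le_dist ?_
  by_contra! hl
  have hk' : dist z (octantCenter k) < 3 / 5 := by
    by_contra! h
    exact hk ((octantBump k).zero_of_le_dist h)
  have hl' : dist z (octantCenter l) < 3 / 5 := hl
  have := dist_triangle_left (octantCenter l) (octantCenter k) z
  linarith [one_lt_dist_octantCenter hkl]

theorem contMDiff_circle_coe :
    ContMDiff (𝓡 1) 𝓘(ℝ, ℂ) ∞ fun z : Circle => (z : ℂ) :=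
  haveI : Fact (Module.finrank ℝ ℂ = 1 + 1) := Complex.finrank_real_complex_fact
  contMDiff_coe_sphere (E := ℂ)

/-! ### Gluing fiber maps over the octants -/

section Gluing

variable {g : Fin 4 → Plane → Plane}

/-- The family of maps of the plane that interpolates between `g k` on the octant `2 * k` and
zero. -/
noncomputable def gluedMap (g : Fin 4 → Plane → Plane) (z : Circle) (v : Plane) : Plane :=
  ∑ k, octantBump k (z : ℂ) • g k v

/-- Disjoint supports leave at most one nonzero summand. Each fiber map is thus a multiple, by a
factor in [0, 1], of a single `g k`, which preserves the disk and gives the dichotomy on the odd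
octants. -/
theorem exists_gluedMap_eq (g : Fin 4 → Plane → Plane) (z : Circle) :
    ∃ k, ∀ v, gluedMap g z v = octantBump k (z : ℂ) • g k v := by
  by_cases h : ∃ k, octantBump k (z : ℂ) ≠ 0
  · obtain ⟨k, hk⟩ := h
    exact ⟨k, fun v => Fintype.sum_eq_single k fun l hl => by
      rw [octantBump_eq_zero_of_ne hl hk, zero_smul]⟩
  · push Not at h
    exact ⟨0, fun v => by simp [gluedMap, h]⟩

theorem gluedMap_of_mem_octant {k : Fin 4} {z : Circle} (hz : z ∈ octant (2 * (k : ℕ)))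
    (v : Plane) : gluedMap g z v = g k v := by
  have h1 := octantBump_eq_one hz
  rw [gluedMap, Fintype.sum_eq_single k fun l hl => by
    rw [octantBump_eq_zero_of_ne hl (h1 ▸ one_ne_zero), zero_smul], h1, one_smul]

theorem norm_gluedMap_le (hg : ∀ k v, ‖g k v‖ ≤ 3) (z : Circle) (v : Plane) :
    ‖gluedMap g z v‖ ≤ 3 := by
  obtain ⟨k, hk⟩ := exists_gluedMap_eq g z
  rw [hk, norm_smul, Real.norm_eq_abs, abs_of_nonneg (octantBump k).nonneg]
  exact (mul_le_of_le_one_left (norm_nonneg _) (octantBump k).le_one).trans (hg k v)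

theorem contMDiff_gluedMap (hg : ∀ k, ContDiff ℝ ∞ (g k)) :
    ContMDiff ((𝓡 1).prod 𝓘(ℝ, Plane)) 𝓘(ℝ, Plane) ∞
      fun x : Circle × Plane => gluedMap g x.1 x.2 := by
  refine contMDiff_finsetSum fun k _ => ?_
  have hb : ContMDiff ((𝓡 1).prod 𝓘(ℝ, Plane)) 𝓘(ℝ, ℝ) ∞
      fun x : Circle × Plane => octantBump k (x.1 : ℂ) :=
    (octantBump k).contDiff.contMDiff.comp (contMDiff_circle_coe.comp contMDiff_fst)
  have hv : ContMDiff ((𝓡 1).prod 𝓘(ℝ, Plane)) 𝓘(ℝ, Plane) ∞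
      fun x : Circle × Plane => g k x.2 := (hg k).contMDiff.comp contMDiff_snd
  exact hb.smul hv

theorem contDiff_gluedMap (hg : ∀ k, ContDiff ℝ ∞ (g k)) (z : Circle) :
    ContDiff ℝ ∞ (gluedMap g z) :=
  ContDiff.sum fun k _ => (hg k).const_smul (octantBump k (z : ℂ))

end Gluing

theorem IsSmoothSolidTorusMap.continuous {F : SolidTorus → SolidTorus}
    (hF : IsSmoothSolidTorusMap F) : Continuous F := by
  obtain ⟨U, G, -, hU, hG, hFG⟩ := hF
  have hincl : Continuous SolidTorus.incl := continuous_id.prodMap continuous_subtype_val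
  have hc : Continuous fun p => (F p).incl := by
    simp only [hFG]
    exact hG.continuousOn.comp_continuous hincl fun p => hU (mem_range_self p)
  exact (continuous_fst.comp hc).prodMk ((continuous_snd.comp hc).subtype_mk fun p => (F p).2.2)

/-- The constant map to `(2, 0)` and the three contracting maps. -/
noncomputable def octantMap (h : ℝ → ℝ) : Fin 4 → Plane → Plane :=
  ![fun _ => !₂[(2 : ℝ), 0], planeFiberMap h 1 0, planeFiberMap h 0 (3 / 2),
    planeFiberMap h 0 (-(3 / 2))]

section OctantMap

variable {h : ℝ → ℝ}

theorem IsDiskProfile.norm_octantMap_le (hh : IsDiskProfile h) (k : Fin 4) (v : Plane) :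
    ‖octantMap h k v‖ ≤ 3 := by
  fin_cases k
  · exact mem_closedBall_zero_iff.1 diskPoint.2
  all_goals exact hh.norm_planeFiberMap_le _ _ v

theorem IsDiskProfile.contDiff_octantMap (hh : IsDiskProfile h) (k : Fin 4) :
    ContDiff ℝ ∞ (octantMap h k) := by
  fin_cases k
  · exact contDiff_const
  all_goals exact hh.contDiff_planeFiberMap _ _

theorem IsDiskProfile.octantMap_apply_zero_nonpos (hh : IsDiskProfile h) {k : Fin 4} (hk : k ≠ 0)
    (v : Plane) : octantMap h k v 0 ≤ 0 := by
  fin_cases k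
  · exact absurd rfl hk
  · exact hh.planeFiberMap_apply_zero_nonpos zero_le_one _ v
  all_goals exact hh.planeFiberMap_apply_zero_nonpos le_rfl _ v

theorem isFiberFamily_of_coe_eq_gluedMap (hh : IsDiskProfile h) {f : Circle → FiberDisk → FiberDisk}
    (hf : ∀ z p, (f z p : Plane) = gluedMap (octantMap h) z p) {f₂ f₄ f₆ : FiberDisk → FiberDisk}
    (h₂ : ∀ p, (f₂ p : Plane) = planeFiberMap h 1 0 p)
    (h₄ : ∀ p, (f₄ p : Plane) = planeFiberMap h 0 (3 / 2) p)
    (h₆ : ∀ p, (f₆ p : Plane) = planeFiberMap h 0 (-(3 / 2)) p) :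
    IsFiberFamily f f₂ f₄ f₆ where
  octant_zero z hz p := (hf z p).trans (gluedMap_of_mem_octant (k := 0) hz _)
  octant_two z hz := funext fun p => Subtype.ext <|
    ((hf z p).trans (gluedMap_of_mem_octant (k := 1) hz _)).trans (h₂ p).symm
  octant_four z hz := funext fun p => Subtype.ext <|
    ((hf z p).trans (gluedMap_of_mem_octant (k := 2) hz _)).trans (h₄ p).symm
  octant_six z hz := funext fun p => Subtype.ext <|
    ((hf z p).trans (gluedMap_of_mem_octant (k := 3) hz _)).trans (h₆ p).symm
  octant_odd _ _ z _ := by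
    obtain ⟨k, hk⟩ := exists_gluedMap_eq (octantMap h) z
    -- A multiple of q is constant on the axis; a nonnegative multiple of a folded map stays in x ≤
    -- 0. This holds at every angle, so membership in an odd octant plays no role.
    rcases eq_or_ne k 0 with rfl | hk0
    · have hc : ∀ p, (f z p : Plane) = octantBump 0 (z : ℂ) • !₂[(2 : ℝ), 0] := fun p =>
        (hf z p).trans (hk p)
      refine .inl ⟨f z diskPoint, by simp [hc], fun p => Subtype.ext ?_⟩
      rw [hc, hc]
    · refine .inr ⟨⟨univ, _, isOpen_univ, subset_univ _,
        (contDiff_gluedMap hh.contDiff_octantMap z).contDiffOn, hf z⟩, ?_⟩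
      rintro _ ⟨p, rfl⟩
      change (f z p : Plane) 0 < 1
      rw [hf, hk]
      exact (mul_nonpos_of_nonneg_of_nonpos (octantBump k).nonneg
        (hh.octantMap_apply_zero_nonpos hk0 p)).trans_lt one_pos

end OctantMap

theorem mainTheorem2 :
    ∃ F : SolidTorus → SolidTorus,
      IsSmoothSolidTorusMap F ∧
      (∃ (f : Circle → FiberDisk → FiberDisk) (f₂ f₄ f₆ : FiberDisk → FiberDisk),
        (∀ (z : Circle) (p : FiberDisk), F (z, p) = (z ^ 8, f z p)) ∧
        IsHutchinsonTriple f₂ f₄ f₆ ∧ IsFiberFamily f f₂ f₄ f₆) ∧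
      ∃ A : Set SolidTorus,
        IsTopologicalAttractor F A ∧ F '' A = A ∧ IsGenericLimitSet F A ∧
        ¬ MapsTo F (interior A) (interior A) := by
  obtain ⟨h, hh⟩ := exists_isDiskProfile
  let f : Circle → FiberDisk → FiberDisk := fun z p => ⟨gluedMap (octantMap h) z p,
    mem_closedBall_zero_iff.2 (norm_gluedMap_le hh.norm_octantMap_le z p)⟩
  let g : ℝ → ℝ → FiberDisk → FiberDisk := fun m c p => ⟨planeFiberMap h m c p,
    mem_closedBall_zero_iff.2 (hh.norm_planeFiberMap_le m c p)⟩
  have ht : IsHutchinsonTriple (g 1 0) (g 0 (3 / 2)) (g 0 (-(3 / 2))) :=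
    isHutchinsonTriple_of_coe_eq hh (fun _ => rfl) (fun _ => rfl) fun _ => rfl
  have hf : IsFiberFamily f (g 1 0) (g 0 (3 / 2)) (g 0 (-(3 / 2))) :=
    isFiberFamily_of_coe_eq_gluedMap hh (fun _ _ => rfl) (fun _ => rfl) (fun _ => rfl) fun _ => rfl
  let F : SolidTorus → SolidTorus := fun x => (x.1 ^ 8, f x.1 x.2)
  have hF : IsSmoothSolidTorusMap F :=
    ⟨univ, fun x => (x.1 ^ 8, gluedMap (octantMap h) x.1 x.2), isOpen_univ, subset_univ _,
      (((contMDiff_pow 8).comp contMDiff_fst).prodMk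
        (contMDiff_gluedMap hh.contDiff_octantMap)).contMDiffOn, fun _ => rfl⟩
  exact ⟨F, hF, ⟨f, _, _, _, fun _ _ => rfl, ht, hf⟩,
    hf.exists_attractor (fun _ _ => rfl) ht hF.continuous⟩
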